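/- Let $p,N$ be integers with $2\le p\le N+1$ and let $\tau=\{t_0,\dots,t_N\}$ with real knots $t_0<t_1<\dots<t_N$; put $t_{-1}:=-\infty$, $t_{N+1}:=\infty$. For a positive integer $n$ and $\xi\in\mathbb{R}^n$ let $|\xi|$ be the Euclidean norm and $\mathcal{L}_\xi:=\left(\frac{d^2}{dt^2}-|\xi|^2\right)^p$. A function $s:\mathbb{R}\to\mathbb{C}$ is a natural $\mathcal{L}_\xi$-spline on $\tau$ if (i) $s\in C^{2p-2}(\mathbb{R})$; (ii) on each interval $(t_{j-1},t_j)$, $0\le j\le N+1$, $s$ is of class $C^{2p}$ and $\mathcal{L}_\xi s=0$; (iii) $\left(\frac{d}{dt}-|\xi|\right)^p s(t)=0$ for all $t<t_0$ and $\left(\frac{d}{dt}+|\xi|\right)^p s(t)=0$ for all $t>t_N$. Theorem. There exists a constant $C_0=C_0(p,\tau)>0$, depending only on $p$ and $\tau$, such that for every positive integer $n$, all $\xi\in\mathbb{R}^n$ with $|\xi|\ge\frac12$ and all $j\in\{0,\dots,N\}$: there is exactly one natural $\mathcal{L}_\xi$-spline $L_{\xi,j}$ on $\tau$ (the Lagrange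 function) with $L_{\xi,j}(t_j)=1$ and $L_{\xi,j}(t_k)=0$ for all $k\in\{0,\dots,N\}\setminus\{j\}$, and for all $m\in\{0,\dots,2p-2\}$ $$\left|\frac{d^m}{dt^m}L_{\xi,j}(t)\right|\le C_0\left(1+|\xi|^m\right),\qquad\forall t\in\mathbb{R}.$$ -/

import Mathlib

/-- The first order operator `d/dt - c`. -/
noncomputable def firstOrderOp (c : ℝ) (f : ℝ → ℂ) : ℝ → ℂ :=
  fun t => deriv f t - (c : ℂ) * f t

/-- The second order operator `d²/dt² - c²`. -/
noncomputable def secondOrderOp (c : ℝ) (f : ℝ → ℂ) : ℝ → ℂ :=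
  fun t => deriv (deriv f) t - (c : ℂ) ^ 2 * f t

/-- The operator `𝓛_ξ = (d²/dt² - |ξ|²)^p`, with `|ξ|` the Euclidean norm. -/
noncomputable def opL (p : ℕ) {n : ℕ} (ξ : EuclideanSpace ℝ (Fin n)) (f : ℝ → ℂ) : ℝ → ℂ :=
  (secondOrderOp ‖ξ‖)^[p] f

/-- For knots `t_0 < ... < t_N` and `j ∈ {0, ..., N + 1}`, the open interval `(t_{j-1}, t_j)`,
where `t_{-1} = -∞` and `t_{N+1} = ∞`: the points above all knots with index `< j` and below all
knots with index `≥ j`. -/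
def openPiece {N : ℕ} (τ : Fin (N + 1) → ℝ) (j : Fin (N + 2)) : Set ℝ :=
  {t | (∀ i : Fin (N + 1), (i : ℕ) < (j : ℕ) → τ i < t) ∧
       (∀ i : Fin (N + 1), (j : ℕ) ≤ (i : ℕ) → t < τ i)}

/-- Natural `𝓛_ξ`-splines on the knots `τ`. The requirement `smooth_pieces` makes the derivatives
of order up to `2p` in the differential equations genuine ones. -/
structure IsNaturalLSpline (p : ℕ) {N n : ℕ} (τ : Fin (N + 1) → ℝ)
    (ξ : EuclideanSpace ℝ (Fin n)) (s : ℝ → ℂ) : Prop where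
  contDiff : ContDiff ℝ ((2 * p - 2 : ℕ) : WithTop ℕ∞) s
  smooth_pieces : ∀ j : Fin (N + 2),
    ContDiffOn ℝ ((2 * p : ℕ) : WithTop ℕ∞) s (openPiece τ j)
  ode : ∀ j : Fin (N + 2), ∀ t ∈ openPiece τ j, opL p ξ s t = 0
  left : ∀ t : ℝ, t < τ 0 → (firstOrderOp ‖ξ‖)^[p] s t = 0
  right : ∀ t : ℝ, τ (Fin.last N) < t → (firstOrderOp (-‖ξ‖))^[p] s t = 0

/-- `L` is a Lagrange function for the knot `τ j`: a natural `𝓛_ξ`-spline with `L (τ j) = 1` and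
`L (τ k) = 0` for `k ≠ j`. -/
def IsLagrangeFunction (p : ℕ) {N n : ℕ} (τ : Fin (N + 1) → ℝ)
    (ξ : EuclideanSpace ℝ (Fin n)) (j : Fin (N + 1)) (L : ℝ → ℂ) : Prop :=
  IsNaturalLSpline p τ ξ L ∧ L (τ j) = 1 ∧ ∀ k : Fin (N + 1), k ≠ j → L (τ k) = 0

/-! Write κ = |ξ|, D = d/dt, a = p - 1, and let φ = `splineKernel a a` be the autocorrelation of
y_+^a e^{-y}/a!. Up to a constant factor, φ(κ(t - t_k)) is a fundamental solution of (D² - κ²)^p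
centred at t_k. It is C^{2p-2}, is killed by (D - κ)^p to the left of t_k and by (D + κ)^p to the
right, so it is a natural spline (`isNaturalLSpline_scaledKernel`).

The interpolation matrix G(κ) = (φ(κ(t_i - t_j))) is, up to a factor, the L² Gram matrix of
translates of one causal function. These translates are linearly independent, so G(κ) is invertible
for κ > 0 (`det_gramMatrix_ne_zero`), and the rows of its inverse are the coefficients of the
Lagrange functions. Since φ decays, G(κ) tends to φ(0) times the identity as κ → ∞, with φ(0) > 0.
With continuity in κ this bounds the inverse uniformly on κ ≥ 1/2 (`exists_bound_inv_gramMatrix`).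
Each derivative of a kernel is κ times a difference of two kernels with values in [0, 1], which
gives the factor (2κ)^m.

Uniqueness is a dimension count: a natural spline is determined by N + 1 numbers
(`IsNaturalLSpline.eq_zero`), while evaluation at the N + 1 knots is onto because Lagrange functions
exist; hence evaluation is also injective. -/

open Polynomial Set Filter Topology MeasureTheory

/-! ### Polynomials in d/dt as differential operators -/

/-- The constant coefficient differential operator `P(d/dt)`. -/
noncomputable def diffOp (P : ℂ[X]) (f : ℝ → ℂ) (t : ℝ) : ℂ :=
  P.sum fun i a => a * iteratedDeriv i f t

lemma diffOp_eq_sum_range {P : ℂ[X]} {n : ℕ} (h : P.natDegree < n) (f : ℝ → ℂ) (t : ℝ) :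
    diffOp P f t = ∑ i ∈ Finset.range n, P.coeff i * iteratedDeriv i f t :=
  P.sum_over_range' (by simp) n h

@[simp] lemma diffOp_one (f : ℝ → ℂ) (t : ℝ) : diffOp 1 f t = f t := by
  rw [diffOp_eq_sum_range (n := 1) (by simp)]; simp

lemma diffOp_add_left (P Q : ℂ[X]) (f : ℝ → ℂ) (t : ℝ) :
    diffOp (P + Q) f t = diffOp P f t + diffOp Q f t :=
  Polynomial.sum_add_index P Q _ (by simp) (by intros; ring)

lemma diffOp_C_mul (c : ℂ) (P : ℂ[X]) (f : ℝ → ℂ) (t : ℝ) :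
    diffOp (C c * P) f t = c * diffOp P f t := by
  have h : (C c * P).natDegree < P.natDegree + 1 := Nat.lt_succ_of_le (natDegree_C_mul_le c P)
  rw [diffOp_eq_sum_range h, diffOp_eq_sum_range (Nat.lt_succ_self _), Finset.mul_sum]
  exact Finset.sum_congr rfl fun i _ => by rw [coeff_C_mul]; ring

lemma diffOp_sub_left (P Q : ℂ[X]) (f : ℝ → ℂ) (t : ℝ) :
    diffOp (P - Q) f t = diffOp P f t - diffOp Q f t := by
  have : P - Q = P + C (-1) * Q := by simp [sub_eq_add_neg]
  rw [this, diffOp_add_left, diffOp_C_mul]; ring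

lemma diffOp_add {P : ℂ[X]} {f g : ℝ → ℂ} {t : ℝ} (hf : ContDiffAt ℝ P.natDegree f t)
    (hg : ContDiffAt ℝ P.natDegree g t) : diffOp P (f + g) t = diffOp P f t + diffOp P g t := by
  simp only [diffOp_eq_sum_range (Nat.lt_succ_self _)]
  rw [← Finset.sum_add_distrib]
  refine Finset.sum_congr rfl fun i hi => ?_
  have hi' : (i : WithTop ℕ∞) ≤ (P.natDegree : WithTop ℕ∞) := by
    exact_mod_cast Nat.lt_succ_iff.mp (Finset.mem_range.mp hi)
  rw [iteratedDeriv_add (hf.of_le hi') (hg.of_le hi')]; ring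

lemma diffOp_smul (P : ℂ[X]) (a : ℂ) (f : ℝ → ℂ) (t : ℝ) :
    diffOp P (a • f) t = a * diffOp P f t := by
  simp only [diffOp_eq_sum_range (Nat.lt_succ_self _), Finset.mul_sum]
  refine Finset.sum_congr rfl fun i hi => ?_
  rw [iteratedDeriv_const_smul_field, smul_eq_mul]; ring

lemma diffOp_fun_zero (P : ℂ[X]) (t : ℝ) : diffOp P 0 t = 0 := by
  simpa using diffOp_smul P 0 0 t

lemma hasDerivAt_diffOp {P : ℂ[X]} {f : ℝ → ℂ} {t : ℝ} {n : ℕ} (hP : P.natDegree < n)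
    (hf : ContDiffAt ℝ n f t) : HasDerivAt (diffOp P f) (diffOp (X * P) f t) t := by
  have h1 : (X * P).natDegree < n + 1 := by
    have := natDegree_mul_le (p := (X : ℂ[X])) (q := P)
    rw [natDegree_X] at this; omega
  have h2 : diffOp P f = fun t => ∑ i ∈ Finset.range n, P.coeff i * iteratedDeriv i f t :=
    funext fun t => diffOp_eq_sum_range hP f t
  rw [diffOp_eq_sum_range h1, Finset.sum_range_succ', h2]
  simp only [coeff_X_mul, coeff_X_mul_zero, zero_mul, add_zero]
  refine HasDerivAt.fun_sum fun i hi => HasDerivAt.const_mul _ ?_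
  rw [iteratedDeriv_succ]
  refine DifferentiableAt.hasDerivAt ?_
  have := ContDiffWithinAt.differentiableWithinAt_iteratedDerivWithin (s := univ) (x := t)
    (n := n) (m := i) (f := f) (𝕜 := ℝ) hf.contDiffWithinAt
    (by exact_mod_cast Finset.mem_range.mp hi) (by simp)
  simpa [iteratedDerivWithin_univ, differentiableWithinAt_univ] using this

/-- Splitting X = c + (X - c) turns the vanishing of the next factor into the equation w' = c w for
w = P(D) f. -/
lemma hasDerivAt_diffOp_of_sub_mul {P : ℂ[X]} {f : ℝ → ℂ} {t : ℝ} {n : ℕ} (c : ℂ)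
    (hP : P.natDegree < n) (hf : ContDiffAt ℝ n f t) :
    HasDerivAt (diffOp P f) (c * diffOp P f t + diffOp ((X - C c) * P) f t) t := by
  convert hasDerivAt_diffOp hP hf using 1
  rw [sub_mul, diffOp_sub_left, diffOp_C_mul]; ring

lemma ContDiff.continuous_diffOp {P : ℂ[X]} {f : ℝ → ℂ} {n : ℕ} (hP : P.natDegree ≤ n)
    (hf : ContDiff ℝ n f) : Continuous (diffOp P f) := by
  have h2 : diffOp P f = fun t => ∑ i ∈ Finset.range (n + 1), P.coeff i * iteratedDeriv i f t :=
    funext fun t => diffOp_eq_sum_range (Nat.lt_succ_of_le hP) f t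
  rw [h2]
  refine continuous_finsetSum _ fun i hi => continuous_const.mul ?_
  exact hf.continuous_iteratedDeriv i
    (by exact_mod_cast Nat.lt_succ_iff.mp (Finset.mem_range.mp hi))

lemma firstOrderOp_iterate_eq_diffOp {U : Set ℝ} (hU : IsOpen U) (c : ℝ) {f : ℝ → ℂ} {n : ℕ}
    (hf : ContDiffOn ℝ n f U) {k : ℕ} (hk : k ≤ n) :
    ∀ t ∈ U, (firstOrderOp c)^[k] f t = diffOp ((X - C (c : ℂ)) ^ k) f t := by
  induction k with
  | zero => intro t _; simp
  | succ k ih =>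
    intro t ht
    -- Differentiating the inductive identity requires it near t, not only at t; hence the induction
    -- over all of the open set U.
    have hev : (firstOrderOp c)^[k] f =ᶠ[𝓝 t] diffOp ((X - C (c : ℂ)) ^ k) f :=
      eventually_of_mem (hU.mem_nhds ht) (ih (by omega))
    have hd := hasDerivAt_diffOp_of_sub_mul (P := (X - C (c : ℂ)) ^ k) (n := n) (c : ℂ)
      (by rw [natDegree_pow, natDegree_X_sub_C]; omega) (hf.contDiffAt (hU.mem_nhds ht))
    rw [Function.iterate_succ_apply', firstOrderOp, hev.deriv_eq, hd.deriv, hev.eq_of_nhds,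
      pow_succ']
    ring

lemma secondOrderOp_iterate_eq_diffOp {U : Set ℝ} (hU : IsOpen U) (c : ℝ) {f : ℝ → ℂ} {n : ℕ}
    (hf : ContDiffOn ℝ n f U) {k : ℕ} (hk : 2 * k ≤ n) :
    ∀ t ∈ U, (secondOrderOp c)^[k] f t = diffOp ((X ^ 2 - C ((c : ℂ) ^ 2)) ^ k) f t := by
  induction k with
  | zero => intro t _; simp
  | succ k ih =>
    set P : ℂ[X] := (X ^ 2 - C ((c : ℂ) ^ 2)) ^ k with hPdef
    have hP : P.natDegree = 2 * k := by rw [hPdef, natDegree_pow, natDegree_X_pow_sub_C]; ring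
    have hXP : (X * P).natDegree < n := by
      have := natDegree_mul_le (p := (X : ℂ[X])) (q := P)
      rw [natDegree_X] at this; omega
    have h1 : ∀ t ∈ U, (secondOrderOp c)^[k] f =ᶠ[𝓝 t] diffOp P f := fun t ht =>
      eventually_of_mem (hU.mem_nhds ht) (ih (by omega))
    have h2 : ∀ t ∈ U, deriv ((secondOrderOp c)^[k] f) t = diffOp (X * P) f t := fun t ht => by
      rw [(h1 t ht).deriv_eq]
      exact (hasDerivAt_diffOp (by omega) (hf.contDiffAt (hU.mem_nhds ht))).deriv
    intro t ht
    have h3 : deriv ((secondOrderOp c)^[k] f) =ᶠ[𝓝 t] diffOp (X * P) f :=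
      eventually_of_mem (hU.mem_nhds ht) h2
    rw [Function.iterate_succ_apply', secondOrderOp, h3.deriv_eq, (h1 t ht).eq_of_nhds,
      (hasDerivAt_diffOp hXP (hf.contDiffAt (hU.mem_nhds ht))).deriv, pow_succ' _ k, ← hPdef, sub_mul,
      diffOp_sub_left, diffOp_C_mul, pow_two (X : ℂ[X]), mul_assoc]

lemma diffOp_pow_mul_eq_zero {U : Set ℝ} (hU : IsOpen U) {f : ℝ → ℂ} {n : ℕ}
    (hf : ContDiffOn ℝ n f U) {P : ℂ[X]} (c : ℂ) {k : ℕ} (hk : P.natDegree + k ≤ n)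
    (hP : ∀ t ∈ U, diffOp P f t = 0) : ∀ t ∈ U, diffOp ((X - C c) ^ k * P) f t = 0 := by
  induction k with
  | zero => simpa using hP
  | succ k ih =>
    intro t ht
    have ih' := ih (by omega)
    have hdeg : ((X - C c) ^ k * P).natDegree < n := by
      have := natDegree_mul_le (p := (X - C c) ^ k) (q := P)
      rw [natDegree_pow, natDegree_X_sub_C] at this; omega
    have h1 := hasDerivAt_diffOp_of_sub_mul c hdeg (hf.contDiffAt (hU.mem_nhds ht))
    have hev : diffOp ((X - C c) ^ k * P) f =ᶠ[𝓝 t] fun _ => 0 :=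
      eventually_of_mem (hU.mem_nhds ht) ih'
    have h2 := h1.deriv
    rw [hev.deriv_eq, deriv_const, ih' t ht, mul_zero, zero_add, ← mul_assoc, ← pow_succ'] at h2
    exact h2.symm

/-! ### Uniqueness for powers of first-order operators -/

/-- Uniqueness for `w' = c w`, where `w` is continuous and the equation may fail at countably many
points. -/
lemma eqOn_zero_of_hasDerivAt_mul_self {U S : Set ℝ} (hU : U.OrdConnected) (hS : S.Countable)
    {w : ℝ → ℂ} (c : ℂ) (hw : ContinuousOn w U)
    (hd : ∀ t ∈ U, t ∉ S → HasDerivAt w (c * w t) t) {a : ℝ} (ha : a ∈ U) (hwa : w a = 0) :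
    ∀ t ∈ U, w t = 0 := by
  intro b hb
  have hsub : uIcc a b ⊆ U := hU.uIcc_subset ha hb
  have he : ∀ t : ℝ, HasDerivAt (fun t : ℝ => Complex.exp (-c * t)) (Complex.exp (-c * t) * (-c)) t :=
    fun t => by simpa using ((hasDerivAt_id t).ofReal_comp.const_mul (-c)).cexp
  -- Integrating factor: e^{-ct} w is continuous with zero derivative off a countable set, hence
  -- constant.
  have key := MeasureTheory.integral_eq_of_hasDerivAt_off_countable
    (fun t : ℝ => Complex.exp (-c * t) * w t) (fun _ => 0) (a := a) (b := b) hS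
    (ContinuousOn.mul (by fun_prop) (hw.mono hsub))
    (fun t ht => by
      have htU : t ∈ U := hsub (Ioo_subset_Icc_self ht.1)
      refine ((he t).mul (hd t htU ht.2)).congr_deriv ?_
      ring) (by simp)
  simp only [hwa, mul_zero, sub_zero, intervalIntegral.integral_zero] at key
  exact (mul_eq_zero.mp key.symm).resolve_left (Complex.exp_ne_zero _)

/-- The factors X - c are peeled off from the highest order down: each (D - c)^j P(D) f solves w' =
c w off S and vanishes at a. Only continuity is needed at the points of S, so this carries zero data
across knots. -/
lemma eqOn_zero_of_diffOp_pow_mul {U S : Set ℝ} (hU : U.OrdConnected) (hS : S.Countable)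
    {f : ℝ → ℂ} {n k : ℕ} {P : ℂ[X]} (c : ℂ) (hn : P.natDegree + k < n)
    (hf : ∀ t ∈ U, t ∉ S → ContDiffAt ℝ n f t) {a : ℝ} (ha : a ∈ U)
    (hcont : ∀ j ≤ k, ContinuousOn (diffOp ((X - C c) ^ j * P) f) U)
    (hzero : ∀ j ≤ k, diffOp ((X - C c) ^ j * P) f a = 0)
    (h : ∀ t ∈ U, t ∉ S → diffOp ((X - C c) ^ (k + 1) * P) f t = 0) :
    ∀ t ∈ U, diffOp P f t = 0 := by
  induction k with
  | zero =>
    have h0 := hcont 0 le_rfl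
    have h1 := hzero 0 le_rfl
    simp only [pow_zero, one_mul] at h0 h1
    refine eqOn_zero_of_hasDerivAt_mul_self hU hS c h0 (fun t ht htS => ?_) ha h1
    have := hasDerivAt_diffOp_of_sub_mul c (by omega) (hf t ht htS) (P := P)
    have h2 := h t ht htS
    rw [zero_add, pow_one] at h2
    rwa [h2, add_zero] at this
  | succ k ih =>
    refine ih (by omega) (fun j hj => hcont j (by omega)) (fun j hj => hzero j (by omega))
      fun t ht _ => eqOn_zero_of_hasDerivAt_mul_self hU hS c (hcont _ le_rfl)
        (fun t ht htS => ?_) ha (hzero _ le_rfl) t ht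
    have hdeg : ((X - C c) ^ (k + 1) * P).natDegree < n := by
      have := natDegree_mul_le (p := (X - C c) ^ (k + 1)) (q := P)
      rw [natDegree_pow, natDegree_X_sub_C] at this; omega
    have := hasDerivAt_diffOp_of_sub_mul c hdeg (hf t ht htS)
    have h2 := h t ht htS
    rwa [← mul_assoc, ← pow_succ', h2, add_zero] at this

/-! ### The pieces between knots -/

lemma isOpen_openPiece {N : ℕ} (τ : Fin (N + 1) → ℝ) (j : Fin (N + 2)) :
    IsOpen (openPiece τ j) := by
  simp only [openPiece, ofPred_and, ofPred_forall]
  refine IsOpen.inter ?_ ?_ <;>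
    refine isOpen_iInter_of_finite fun i => isOpen_iInter_of_finite fun _ => ?_
  · exact isOpen_lt continuous_const continuous_id
  · exact isOpen_lt continuous_id continuous_const

lemma ordConnected_openPiece {N : ℕ} (τ : Fin (N + 1) → ℝ) (j : Fin (N + 2)) :
    (openPiece τ j).OrdConnected :=
  ⟨fun _ hx _ hy _ hz =>
    ⟨fun i hi => (hx.1 i hi).trans_le hz.1, fun i hi => hz.2.trans_lt (hy.2 i hi)⟩⟩

lemma openPiece_zero {N : ℕ} {τ : Fin (N + 1) → ℝ} (hτ : StrictMono τ) :
    openPiece τ 0 = Iio (τ 0) := by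
  ext t
  simp only [openPiece, mem_ofPred_eq, mem_Iio, Fin.val_zero, not_lt_zero, false_imp_iff,
    implies_true, true_and, zero_le, true_imp_iff]
  exact ⟨fun h => h 0, fun h i => h.trans_le (hτ.monotone (Fin.zero_le i))⟩

lemma openPiece_last {N : ℕ} {τ : Fin (N + 1) → ℝ} (hτ : StrictMono τ) :
    openPiece τ (Fin.last (N + 1)) = Ioi (τ (Fin.last N)) := by
  ext t
  simp only [openPiece, mem_ofPred_eq, mem_Ioi, Fin.val_last]
  exact ⟨fun h => h.1 _ (by simp), fun h => ⟨fun i _ => (hτ.monotone (Fin.le_last i)).trans_lt h,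
    fun i hi => absurd i.2 (by omega)⟩⟩

lemma exists_mem_openPiece {N : ℕ} {τ : Fin (N + 1) → ℝ} (hτ : StrictMono τ) {t : ℝ}
    (ht : t ∉ range τ) : ∃ j, t ∈ openPiece τ j := by
  by_cases h : ∃ i, t < τ i
  · classical
    -- The index of the piece is the least index of a knot above t.
    have h' : ∃ n : ℕ, ∃ hn : n < N + 1, t < τ ⟨n, hn⟩ := ⟨h.choose, h.choose.2, h.choose_spec⟩
    obtain ⟨hn, hlt⟩ := Nat.find_spec h'
    refine ⟨⟨Nat.find h', by omega⟩, fun i hi => ?_, fun i hi => hlt.trans_le (hτ.monotone hi)⟩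
    refine lt_of_le_of_ne (not_lt.mp fun hti => Nat.find_min h' hi ⟨i.2, hti⟩) ?_
    exact fun he => ht ⟨i, he⟩
  · push Not at h
    refine ⟨Fin.last _, ?_⟩
    rw [openPiece_last hτ]
    exact lt_of_le_of_ne (h _) fun he => ht ⟨_, he⟩

lemma notMem_range_of_mem_openPiece {N : ℕ} {τ : Fin (N + 1) → ℝ} {j : Fin (N + 2)} {t : ℝ}
    (ht : t ∈ openPiece τ j) : t ∉ range τ := by
  rintro ⟨i, rfl⟩
  rcases lt_or_ge (i : ℕ) j with h | h
  · exact lt_irrefl _ (ht.1 i h)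
  · exact lt_irrefl _ (ht.2 i h)

lemma nonempty_openPiece_succ {N : ℕ} {τ : Fin (N + 1) → ℝ} (hτ : StrictMono τ)
    (j : Fin (N + 1)) : (openPiece τ j.succ).Nonempty := by
  have h : ∀ᶠ t in 𝓝[>] (τ j), ∀ i, j < i → t < τ i :=
    eventually_all.mpr fun i => by
      by_cases hji : j < i
      · filter_upwards [nhdsWithin_le_nhds (Iio_mem_nhds (hτ hji))] with t ht _ using ht
      · exact Eventually.of_forall fun t h => absurd h hji
  obtain ⟨t, ht, htj⟩ := (h.and self_mem_nhdsWithin).exists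
  refine ⟨t, fun i hi => (hτ.monotone ?_).trans_lt htj, fun i hi => ht i ?_⟩
  · rw [Fin.val_succ] at hi; exact Fin.le_def.mpr (by omega)
  · rw [Fin.val_succ] at hi; exact Fin.lt_def.mpr (by omega)

/-! ### The space of natural splines has dimension at most N + 1 -/

lemma sub_C_mul_sub_C_neg (κ : ℝ) :
    (X - C ((-κ : ℝ) : ℂ)) * (X - C (κ : ℂ)) = X ^ 2 - C ((κ : ℂ) ^ 2) := by
  simp only [Complex.ofReal_neg, C_neg, C_pow]; ring

/-- The factored form separates the two exponents ±|ξ|. The one-sided conditions need only global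
smoothness, because p ≤ 2p - 2 for p ≥ 2. -/
lemma isNaturalLSpline_iff {p N n : ℕ} (hp : 2 ≤ p) (τ : Fin (N + 1) → ℝ)
    (ξ : EuclideanSpace ℝ (Fin n)) (s : ℝ → ℂ) :
    IsNaturalLSpline p τ ξ s ↔ ContDiff ℝ ((2 * p - 2 : ℕ) : WithTop ℕ∞) s ∧
      (∀ j, ContDiffOn ℝ ((2 * p : ℕ) : WithTop ℕ∞) s (openPiece τ j)) ∧
      (∀ j, ∀ t ∈ openPiece τ j,
        diffOp ((X - C ((-‖ξ‖ : ℝ) : ℂ)) ^ p * (X - C (‖ξ‖ : ℂ)) ^ p) s t = 0) ∧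
      (∀ t < τ 0, diffOp ((X - C (‖ξ‖ : ℂ)) ^ p) s t = 0) ∧
      ∀ t > τ (Fin.last N), diffOp ((X - C ((-‖ξ‖ : ℝ) : ℂ)) ^ p) s t = 0 := by
  have h1 : ∀ c : ℝ, ContDiff ℝ ((2 * p - 2 : ℕ) : WithTop ℕ∞) s →
      ∀ t, (firstOrderOp c)^[p] s t = diffOp ((X - C (c : ℂ)) ^ p) s t := fun c hs t =>
    firstOrderOp_iterate_eq_diffOp isOpen_univ c hs.contDiffOn (by omega) t (mem_univ t)
  have h2 : ∀ j, ContDiffOn ℝ ((2 * p : ℕ) : WithTop ℕ∞) s (openPiece τ j) →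
      ∀ t ∈ openPiece τ j, opL p ξ s t =
        diffOp ((X - C ((-‖ξ‖ : ℝ) : ℂ)) ^ p * (X - C (‖ξ‖ : ℂ)) ^ p) s t := fun j hj => by
    rw [← mul_pow, sub_C_mul_sub_C_neg]
    exact secondOrderOp_iterate_eq_diffOp (isOpen_openPiece τ j) ‖ξ‖ hj le_rfl
  constructor
  · intro h
    refine ⟨h.contDiff, h.smooth_pieces, fun j t ht => ?_, fun t ht => ?_, fun t ht => ?_⟩
    · rw [← h2 j (h.smooth_pieces j) t ht, h.ode j t ht]
    · rw [← h1 _ h.contDiff, h.left t ht]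
    · rw [← h1 _ h.contDiff, h.right t ht]
  · rintro ⟨a, b, c, d, e⟩
    refine ⟨a, b, fun j t ht => ?_, fun t ht => ?_, fun t ht => ?_⟩
    · rw [h2 j (b j) t ht, c j t ht]
    · rw [h1 _ a, d t ht]
    · rw [h1 _ a, e t ht]

lemma natDegree_pow_mul_pow_X_sub_C (c d : ℂ) (k l : ℕ) :
    ((X - C c) ^ k * (X - C d) ^ l).natDegree = k + l := by
  rw [natDegree_mul (pow_ne_zero _ (X_sub_C_ne_zero _)) (pow_ne_zero _ (X_sub_C_ne_zero _)),
    natDegree_pow, natDegree_pow, natDegree_X_sub_C, natDegree_X_sub_C, mul_one, mul_one]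

/-- Solutions of `(d/dt - c)^k f = 0` and `(d/dt - d)^l f = 0` with `c ≠ d` vanish. -/
lemma eq_zero_of_diffOp_pow_of_diffOp_pow {U : Set ℝ} (hU : IsOpen U) {f : ℝ → ℂ} {c d : ℂ}
    (hcd : c ≠ d) {k l : ℕ} (hf : ContDiffOn ℝ ((k + l : ℕ) : WithTop ℕ∞) f U)
    (hk : ∀ t ∈ U, diffOp ((X - C c) ^ k) f t = 0)
    (hl : ∀ t ∈ U, diffOp ((X - C d) ^ l) f t = 0) : ∀ t ∈ U, f t = 0 := by
  induction k with
  | zero => simpa using hk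
  | succ k ih =>
    refine ih (hf.of_le (by exact_mod_cast (by omega : k + l ≤ k + 1 + l))) fun t ht => ?_
    -- Since (D - c) kills g = (D - c)^k f, the operator D - d acts on g as multiplication by c - d
    -- ≠ 0. As (D - d)^l also kills g, this forces g = 0.
    have key : ∀ i ≤ l, diffOp ((X - C d) ^ i * (X - C c) ^ k) f t =
        (c - d) ^ i * diffOp ((X - C c) ^ k) f t := by
      intro i hi
      induction i with
      | zero => simp
      | succ i ihi =>
        have e : (X - C d) ^ (i + 1) * (X - C c) ^ k =
            (X - C d) ^ i * (X - C c) ^ (k + 1) + C (c - d) * ((X - C d) ^ i * (X - C c) ^ k) := by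
          rw [C_sub]; ring
        rw [e, diffOp_add_left, diffOp_C_mul, ihi (by omega),
          diffOp_pow_mul_eq_zero hU hf d (k := i) ?_ hk t ht]
        · ring
        · rw [natDegree_pow, natDegree_X_sub_C]; omega
    have h1 := key l le_rfl
    rw [mul_comm, diffOp_pow_mul_eq_zero hU hf c ?_ hl t ht] at h1
    · exact (mul_eq_zero.mp h1.symm).resolve_left (pow_ne_zero _ (sub_ne_zero.mpr hcd))
    · rw [natDegree_pow, natDegree_X_sub_C]; omega

/-- A natural spline is determined by the values of `(d/dt + |ξ|)^(p-1) (d/dt - |ξ|)^p s` at one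
point of each piece except the first. -/
lemma IsNaturalLSpline.eq_zero {p N n : ℕ} (hp : 2 ≤ p) {τ : Fin (N + 1) → ℝ}
    (hτ : StrictMono τ) {ξ : EuclideanSpace ℝ (Fin n)} (hξ : 0 < ‖ξ‖) {s : ℝ → ℂ}
    (hs : IsNaturalLSpline p τ ξ s) {m : Fin (N + 1) → ℝ} (hm : ∀ j, m j ∈ openPiece τ j.succ)
    (h : ∀ j, diffOp ((X - C ((-‖ξ‖ : ℝ) : ℂ)) ^ (p - 1) * (X - C (‖ξ‖ : ℂ)) ^ p) s (m j) = 0) :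
    s = 0 := by
  obtain ⟨hC, hP, hode, hleft, hright⟩ := (isNaturalLSpline_iff hp τ ξ s).mp hs
  have hcd : (‖ξ‖ : ℂ) ≠ ((-‖ξ‖ : ℝ) : ℂ) := by
    intro h; have := Complex.ofReal_injective h; linarith
  generalize hc : (‖ξ‖ : ℂ) = c at *
  generalize hd : ((-‖ξ‖ : ℝ) : ℂ) = d at *
  have hPat : ∀ t, t ∉ range τ → ContDiffAt ℝ ((2 * p : ℕ) : WithTop ℕ∞) s t := fun t ht => by
    obtain ⟨j, hj⟩ := exists_mem_openPiece hτ ht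
    exact (hP j).contDiffAt ((isOpen_openPiece τ j).mem_nhds hj)
  have hIio : ContDiffOn ℝ ((2 * p : ℕ) : WithTop ℕ∞) s (Iio (τ 0)) := openPiece_zero hτ ▸ hP 0
  have hIoi : ContDiffOn ℝ ((2 * p : ℕ) : WithTop ℕ∞) s (Ioi (τ (Fin.last N))) :=
    openPiece_last hτ ▸ hP (Fin.last _)
  have hL : ∀ k ≤ p, ∀ t < τ 0, diffOp ((X - C d) ^ k * (X - C c) ^ p) s t = 0 := fun k hk =>
    diffOp_pow_mul_eq_zero isOpen_Iio hIio d
      (by rw [natDegree_pow, natDegree_X_sub_C]; omega) hleft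
  -- On each piece w = (D - d)^(p-1) (D - c)^p s solves w' = d w, so one zero suffices: the left
  -- condition supplies it on the first piece, the hypothesis on the others.
  have h1 : ∀ t, t ∉ range τ → diffOp ((X - C d) ^ (p - 1) * (X - C c) ^ p) s t = 0 := by
    intro t ht
    obtain ⟨j, hj⟩ := exists_mem_openPiece hτ ht
    rcases Fin.eq_zero_or_eq_succ j with rfl | ⟨j, rfl⟩
    · rw [openPiece_zero hτ] at hj
      exact hL _ (by omega) t hj
    · have hdeg : ((X - C d) ^ (p - 1) * (X - C c) ^ p).natDegree < 2 * p := by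
        rw [natDegree_pow_mul_pow_X_sub_C]; omega
      have hD : ∀ t ∈ openPiece τ j.succ, HasDerivAt
          (diffOp ((X - C d) ^ (p - 1) * (X - C c) ^ p) s)
          (d * diffOp ((X - C d) ^ (p - 1) * (X - C c) ^ p) s t) t := fun t ht => by
        have := hasDerivAt_diffOp_of_sub_mul d hdeg (hPat t (notMem_range_of_mem_openPiece ht))
        rwa [← mul_assoc, ← pow_succ', Nat.sub_add_cancel (by omega), hode _ t ht, add_zero] at this
      exact eqOn_zero_of_hasDerivAt_mul_self (ordConnected_openPiece τ j.succ) countable_empty d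
        (fun t ht => (hD t ht).continuousAt.continuousWithinAt) (fun t ht _ => hD t ht)
        (hm j) (h j) t hj
  obtain ⟨q, rfl⟩ : ∃ q, p = q + 2 := ⟨p - 2, by omega⟩
  -- With p = q + 2, the functions (D - d)^j (D - c)^p s, j ≤ q, have order at most 2p - 2, hence
  -- are continuous across knots, and they vanish left of the first knot.
  have h2 : ∀ t, diffOp ((X - C c) ^ (q + 2)) s t = 0 := fun t =>
    eqOn_zero_of_diffOp_pow_mul (S := range τ) (k := q) ordConnected_univ (finite_range τ).countable
      d (by rw [natDegree_pow, natDegree_X_sub_C]; omega) (fun t _ ht => hPat t ht)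
      (mem_univ (τ 0 - 1))
      (fun j hj => (hC.continuous_diffOp
        (by rw [natDegree_pow_mul_pow_X_sub_C]; omega)).continuousOn)
      (fun j hj => hL j (by omega) _ (by linarith)) (fun t _ ht => h1 t ht) t (mem_univ t)
  -- Beyond the last knot both (D - c)^p and (D - d)^p kill s, and c ≠ d. The zero found there then
  -- propagates back to the whole line through (D - c)^p s = 0.
  have h3 : ∀ t ∈ Ioi (τ (Fin.last N)), s t = 0 :=
    eq_zero_of_diffOp_pow_of_diffOp_pow isOpen_Ioi hcd
      (hIoi.of_le (by exact_mod_cast (by omega : q + 2 + (q + 2) ≤ 2 * (q + 2))))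
      (fun t _ => h2 t) hright
  have h4 : ∀ k ≤ q + 2, ∀ t ∈ Ioi (τ (Fin.last N)), diffOp ((X - C c) ^ k * 1) s t = 0 :=
    fun k hk => diffOp_pow_mul_eq_zero isOpen_Ioi hIoi c (by simp; omega) (by simpa using h3)
  ext t
  have h5 := eqOn_zero_of_diffOp_pow_mul (S := range τ) (k := q + 1) (P := 1) (f := s) (U := univ)
    (n := 2 * (q + 2)) ordConnected_univ (finite_range τ).countable c
    (by simp; omega) (fun t _ ht => hPat t ht)
    (mem_univ (τ (Fin.last N) + 1))
    (fun j hj => (hC.continuous_diffOp (by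
      rw [mul_one, natDegree_pow, natDegree_X_sub_C]; omega)).continuousOn)
    (fun j hj => h4 j (by omega) _ (by simp)) (fun t _ _ => by simpa using h2 t) t (mem_univ t)
  simpa using h5

/-- The space of natural splines. -/
def naturalSplineSpace (p : ℕ) (hp : 2 ≤ p) {N n : ℕ} (τ : Fin (N + 1) → ℝ)
    (ξ : EuclideanSpace ℝ (Fin n)) : Submodule ℂ (ℝ → ℂ) where
  carrier := {s | IsNaturalLSpline p τ ξ s}
  zero_mem' := by
    rw [mem_ofPred_eq, isNaturalLSpline_iff hp]
    exact ⟨contDiff_const, fun _ => contDiffOn_const, by simp [diffOp_fun_zero],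
      by simp [diffOp_fun_zero], by simp [diffOp_fun_zero]⟩
  add_mem' := by
    intro f g hf hg
    rw [mem_ofPred_eq, isNaturalLSpline_iff hp] at hf hg ⊢
    have hdeg : ∀ c : ℂ, ((X - C c) ^ p).natDegree ≤ 2 * p - 2 := fun c => by
      rw [natDegree_pow, natDegree_X_sub_C]; omega
    refine ⟨hf.1.add hg.1, fun j => (hf.2.1 j).add (hg.2.1 j), fun j t ht => ?_,
      fun t ht => ?_, fun t ht => ?_⟩
    · have hnhds := (isOpen_openPiece τ j).mem_nhds ht
      have hn : ((X - C ((-‖ξ‖ : ℝ) : ℂ)) ^ p * (X - C (‖ξ‖ : ℂ)) ^ p).natDegree = 2 * p := by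
        rw [natDegree_pow_mul_pow_X_sub_C]; omega
      rw [diffOp_add (by rw [hn]; exact (hf.2.1 j).contDiffAt hnhds)
        (by rw [hn]; exact (hg.2.1 j).contDiffAt hnhds), hf.2.2.1 j t ht, hg.2.2.1 j t ht, add_zero]
    · rw [diffOp_add (hf.1.contDiffAt.of_le (by exact_mod_cast hdeg _))
        (hg.1.contDiffAt.of_le (by exact_mod_cast hdeg _)), hf.2.2.2.1 t ht, hg.2.2.2.1 t ht,
        add_zero]
    · rw [diffOp_add (hf.1.contDiffAt.of_le (by exact_mod_cast hdeg _))
        (hg.1.contDiffAt.of_le (by exact_mod_cast hdeg _)), hf.2.2.2.2 t ht, hg.2.2.2.2 t ht,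
        add_zero]
  smul_mem' := by
    intro a f hf
    rw [mem_ofPred_eq, isNaturalLSpline_iff hp] at hf ⊢
    refine ⟨contDiff_const.smul hf.1, fun j => contDiffOn_const.smul (hf.2.1 j), fun j t ht => ?_,
      fun t ht => ?_, fun t ht => ?_⟩
    · rw [diffOp_smul, hf.2.2.1 j t ht, mul_zero]
    · rw [diffOp_smul, hf.2.2.2.1 t ht, mul_zero]
    · rw [diffOp_smul, hf.2.2.2.2 t ht, mul_zero]

/-- If every knot has a Lagrange function, then a natural spline vanishing at the knots is zero. -/
lemma IsNaturalLSpline.eq_zero_of_knots {p N n : ℕ} (hp : 2 ≤ p) {τ : Fin (N + 1) → ℝ}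
    (hτ : StrictMono τ) {ξ : EuclideanSpace ℝ (Fin n)} (hξ : 0 < ‖ξ‖)
    (hex : ∀ j, ∃ L, IsLagrangeFunction p τ ξ j L) {s : ℝ → ℂ}
    (hs : IsNaturalLSpline p τ ξ s) (h0 : ∀ j, s (τ j) = 0) : s = 0 := by
  choose m hm using nonempty_openPiece_succ hτ
  let S := naturalSplineSpace p hp τ ξ
  let P : ℂ[X] := (X - C ((-‖ξ‖ : ℝ) : ℂ)) ^ (p - 1) * (X - C (‖ξ‖ : ℂ)) ^ p
  have hPdeg : P.natDegree ≤ 2 * p := by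
    simp only [P]; rw [natDegree_pow_mul_pow_X_sub_C]; omega
  let A : S →ₗ[ℂ] (Fin (N + 1) → ℂ) :=
    { toFun := fun s j => diffOp P s (m j)
      map_add' := fun f g => by
        ext j
        have hnhds := (isOpen_openPiece τ j.succ).mem_nhds (hm j)
        have hf : IsNaturalLSpline p τ ξ f := f.2
        have hg : IsNaturalLSpline p τ ξ g := g.2
        exact diffOp_add
          (((hf.smooth_pieces j.succ).contDiffAt hnhds).of_le (by exact_mod_cast hPdeg))
          (((hg.smooth_pieces j.succ).contDiffAt hnhds).of_le (by exact_mod_cast hPdeg))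
      map_smul' := fun a f => by
        ext j
        exact diffOp_smul P a f (m j) }
  have hA : Function.Injective A := by
    refine (injective_iff_map_eq_zero A).mpr fun f hf => Subtype.ext ?_
    exact IsNaturalLSpline.eq_zero hp hτ hξ f.2 hm fun j => congrFun hf j
  let E : S →ₗ[ℂ] (Fin (N + 1) → ℂ) :=
    { toFun := fun s j => (s : ℝ → ℂ) (τ j)
      map_add' := fun _ _ => rfl
      map_smul' := fun _ _ => rfl }
  have hE : Function.Surjective E := by
    choose L hL using hex
    intro v
    refine ⟨∑ j, v j • ⟨L j, (hL j).1⟩, ?_⟩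
    ext k
    rw [map_sum, Finset.sum_apply, Finset.sum_eq_single k]
    · simp [E, (hL k).2.1]
    · intro j _ hjk
      simp [E, (hL j).2.2 k hjk.symm]
    · simp
  have : FiniteDimensional ℂ S := FiniteDimensional.of_injective A hA
  -- Injectivity of A bounds the dimension above by N + 1, surjectivity of E below; a surjection
  -- between equal finite dimensions is injective.
  have hrank : Module.finrank ℂ S = Module.finrank ℂ (Fin (N + 1) → ℂ) :=
    le_antisymm (LinearMap.finrank_le_finrank_of_injective hA)
      (LinearMap.finrank_le_finrank_of_surjective hE)
  have hEinj := (LinearMap.injective_iff_surjective_of_finrank_eq_finrank hrank).mpr hE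
  have : (⟨s, hs⟩ : S) = 0 := hEinj (by rw [map_zero]; ext j; exact h0 j)
  exact congrArg Subtype.val this

/-! ### The model kernel -/

/-- The value at `0` of the convolution of `y^j e^{-y} / j!` and its reflection for `b`. -/
noncomputable def kernelCoeff (j b : ℕ) : ℝ := (j + b).choose b / 2 ^ (j + b + 1)

/-- The polynomial factor of `splineKernel a b` on the right half-line. -/
noncomputable def kernelPoly (a b : ℕ) (x : ℝ) : ℝ :=
  ∑ i ∈ Finset.range (a + 1), x ^ i / i.factorial * kernelCoeff (a - i) b

/-- The correlation of `y_+^a e^{-y} / a!` and `y_+^b e^{-y} / b!`, a fundamental solution of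
`(1 + d/dx)^(a+1) (1 - d/dx)^(b+1)`. -/
noncomputable def splineKernel (a b : ℕ) (x : ℝ) : ℝ :=
  if 0 ≤ x then Real.exp (-x) * kernelPoly a b x else Real.exp x * kernelPoly b a (-x)

lemma kernelCoeff_comm (j b : ℕ) : kernelCoeff j b = kernelCoeff b j := by
  rw [kernelCoeff, kernelCoeff, add_comm b j, Nat.choose_symm_add]

lemma kernelCoeff_zero_succ (b : ℕ) : 2 * kernelCoeff 0 (b + 1) = kernelCoeff 0 b := by
  simp only [kernelCoeff, zero_add, Nat.choose_self]
  field_simp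
  ring

/-- Pascal's rule; it is the source of the derivative rule in the index `b`. -/
lemma kernelCoeff_succ_succ (j b : ℕ) :
    2 * kernelCoeff (j + 1) (b + 1) = kernelCoeff (j + 1) b + kernelCoeff j (b + 1) := by
  have h : (j + 1 + (b + 1)).choose (b + 1) = (j + 1 + b).choose b + (j + (b + 1)).choose (b + 1) := by
    rw [show j + 1 + (b + 1) = (j + 1 + b) + 1 by ring, Nat.choose_succ_succ,
      show j + 1 + b = j + (b + 1) by ring]
  simp only [kernelCoeff, h, Nat.cast_add]
  rw [show j + 1 + (b + 1) + 1 = (j + b + 2) + 1 by ring, show j + 1 + b + 1 = j + b + 2 by ring,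
    show j + (b + 1) + 1 = j + b + 2 by ring, pow_succ]
  field_simp

lemma kernelCoeff_nonneg (j b : ℕ) : 0 ≤ kernelCoeff j b := by unfold kernelCoeff; positivity

lemma kernelCoeff_le_one (j b : ℕ) : kernelCoeff j b ≤ 1 := by
  rw [kernelCoeff, div_le_one (by positivity), pow_succ]
  have : ((j + b).choose b : ℝ) ≤ 2 ^ (j + b) := by exact_mod_cast Nat.choose_le_two_pow _ _
  nlinarith [pow_pos (two_pos (α := ℝ)) (j + b)]

lemma kernelPoly_zero_left (b : ℕ) (x : ℝ) : kernelPoly 0 b x = kernelCoeff 0 b := by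
  simp [kernelPoly]

lemma kernelPoly_apply_zero (a b : ℕ) : kernelPoly a b 0 = kernelCoeff a b := by
  rw [kernelPoly, Finset.sum_range_succ']
  simp

lemma hasDerivAt_kernelPoly_succ (a b : ℕ) (x : ℝ) :
    HasDerivAt (kernelPoly (a + 1) b) (kernelPoly a b x) x := by
  have e : kernelPoly (a + 1) b = fun x => ∑ i ∈ Finset.range (a + 1),
      x ^ (i + 1) / (i + 1).factorial * kernelCoeff (a - i) b + kernelCoeff (a + 1) b := by
    ext x
    rw [kernelPoly, Finset.sum_range_succ']
    simp
  rw [e]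
  refine HasDerivAt.add_const _ (HasDerivAt.fun_sum fun i _ => HasDerivAt.mul_const ?_ _)
  refine ((hasDerivAt_pow (i + 1) x).div_const _).congr_deriv ?_
  rw [Nat.factorial_succ, Nat.add_sub_cancel]
  push_cast
  field_simp

lemma kernelPoly_succ_right (a b : ℕ) (x : ℝ) :
    2 * kernelPoly (a + 1) (b + 1) x = kernelPoly (a + 1) b x + kernelPoly a (b + 1) x := by
  simp only [kernelPoly]
  rw [Finset.sum_range_succ, Finset.sum_range_succ _ (a + 1), Nat.sub_self, mul_add,
    ← kernelCoeff_zero_succ b, Finset.mul_sum]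
  have h : ∀ i ∈ Finset.range (a + 1),
      2 * (x ^ i / i.factorial * kernelCoeff (a + 1 - i) (b + 1)) =
        x ^ i / i.factorial * kernelCoeff (a + 1 - i) b +
        x ^ i / i.factorial * kernelCoeff (a - i) (b + 1) := fun i hi => by
    rw [Nat.succ_sub (Nat.lt_succ_iff.mp (Finset.mem_range.mp hi)), Nat.succ_eq_add_one]
    linear_combination (x ^ i / i.factorial) * kernelCoeff_succ_succ (a - i) b
  rw [Finset.sum_congr rfl h, Finset.sum_add_distrib]
  ring

/-- Equivalently, 1 - d/dx lowers `b` by one on e^{-x} `kernelPoly a (b + 1) x`. -/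
lemma hasDerivAt_kernelPoly (a b : ℕ) (x : ℝ) :
    HasDerivAt (kernelPoly a (b + 1)) (2 * kernelPoly a (b + 1) x - kernelPoly a b x) x := by
  cases a with
  | zero =>
    have e : kernelPoly 0 (b + 1) = fun _ => kernelCoeff 0 (b + 1) :=
      funext fun x => kernelPoly_zero_left _ x
    rw [kernelPoly_zero_left, kernelPoly_zero_left, kernelCoeff_zero_succ, sub_self, e]
    exact hasDerivAt_const x _
  | succ a =>
    convert hasDerivAt_kernelPoly_succ a (b + 1) x using 1
    rw [kernelPoly_succ_right]; ring

lemma contDiff_kernelPoly (a b : ℕ) {n : WithTop ℕ∞} : ContDiff ℝ n (kernelPoly a b) := by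
  unfold kernelPoly; fun_prop

lemma kernelPoly_nonneg (a b : ℕ) {x : ℝ} (hx : 0 ≤ x) : 0 ≤ kernelPoly a b x :=
  Finset.sum_nonneg fun i _ => mul_nonneg (by positivity) (kernelCoeff_nonneg _ _)

/-- Coefficients at most 1 leave a partial sum of the exponential series. -/
lemma kernelPoly_le_exp (a b : ℕ) {x : ℝ} (hx : 0 ≤ x) : kernelPoly a b x ≤ Real.exp x := by
  refine le_trans (Finset.sum_le_sum fun i _ => ?_) (Real.sum_le_exp_of_nonneg hx (a + 1))
  exact mul_le_of_le_one_right (by positivity) (kernelCoeff_le_one _ _)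

lemma splineKernel_of_nonneg (a b : ℕ) {x : ℝ} (hx : 0 ≤ x) :
    splineKernel a b x = Real.exp (-x) * kernelPoly a b x := if_pos hx

lemma splineKernel_of_nonpos (a b : ℕ) {x : ℝ} (hx : x ≤ 0) :
    splineKernel a b x = Real.exp x * kernelPoly b a (-x) := by
  rcases hx.lt_or_eq with h | rfl
  · exact if_neg (not_le.mpr h)
  · simp [splineKernel, kernelPoly_apply_zero, kernelCoeff_comm a b]

lemma splineKernel_neg (a b : ℕ) (x : ℝ) : splineKernel a b (-x) = splineKernel b a x := by
  rcases le_total 0 x with h | h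
  · rw [splineKernel_of_nonneg _ _ h, splineKernel_of_nonpos _ _ (by linarith), neg_neg]
  · rw [splineKernel_of_nonpos _ _ h, splineKernel_of_nonneg _ _ (by linarith), neg_neg]

lemma splineKernel_zero (a b : ℕ) : splineKernel a b 0 = kernelCoeff a b := by
  rw [splineKernel_of_nonneg _ _ le_rfl, kernelPoly_apply_zero]; simp

lemma splineKernel_nonneg (a b : ℕ) (x : ℝ) : 0 ≤ splineKernel a b x := by
  rcases le_total 0 x with h | h
  · rw [splineKernel_of_nonneg _ _ h]
    exact mul_nonneg (Real.exp_pos _).le (kernelPoly_nonneg _ _ h)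
  · rw [splineKernel_of_nonpos _ _ h]
    exact mul_nonneg (Real.exp_pos _).le (kernelPoly_nonneg _ _ (by linarith))

lemma splineKernel_le_one (a b : ℕ) (x : ℝ) : splineKernel a b x ≤ 1 := by
  have key : ∀ a b : ℕ, ∀ x : ℝ, 0 ≤ x → splineKernel a b x ≤ 1 := fun a b x hx => by
    rw [splineKernel_of_nonneg _ _ hx]
    refine (mul_le_mul_of_nonneg_left (kernelPoly_le_exp a b hx) (Real.exp_pos _).le).trans ?_
    rw [← Real.exp_add, neg_add_cancel, Real.exp_zero]
  rcases le_total 0 x with h | h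
  · exact key a b x h
  · rw [← splineKernel_neg]
    exact key b a (-x) (by linarith)

lemma tendsto_splineKernel_atTop (a b : ℕ) : Tendsto (splineKernel a b) atTop (𝓝 0) := by
  have h : Tendsto (fun x => ∑ i ∈ Finset.range (a + 1),
      (x ^ i * Real.exp (-x)) * (kernelCoeff (a - i) b / i.factorial)) atTop (𝓝 0) := by
    have := tendsto_finsetSum (Finset.range (a + 1)) fun i _ =>
      (Real.tendsto_pow_mul_exp_neg_atTop_nhds_zero i).mul_const
        (kernelCoeff (a - i) b / i.factorial)
    simpa using this
  refine h.congr' ?_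
  filter_upwards [eventually_ge_atTop 0] with x hx
  rw [splineKernel_of_nonneg _ _ hx, kernelPoly, Finset.mul_sum]
  exact Finset.sum_congr rfl fun i _ => by ring

lemma tendsto_splineKernel_atBot (a b : ℕ) : Tendsto (splineKernel a b) atBot (𝓝 0) := by
  have := (tendsto_splineKernel_atTop b a).comp tendsto_neg_atBot_atTop
  exact this.congr fun x => splineKernel_neg b a x

lemma HasDerivAt.ite_nonneg {f g : ℝ → ℝ} {f' g' : ℝ} {x : ℝ} (h0 : f 0 = g 0)
    (hf : 0 ≤ x → HasDerivAt f f' x) (hg : x ≤ 0 → HasDerivAt g g' x) (h0' : x = 0 → f' = g') :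
    HasDerivAt (fun x => if 0 ≤ x then f x else g x) (if 0 ≤ x then f' else g') x := by
  rcases lt_trichotomy x 0 with h | h | h
  · rw [if_neg (not_le.mpr h)]
    refine (hg h.le).congr_of_eventuallyEq ?_
    filter_upwards [Iio_mem_nhds h] with y hy using if_neg (not_le.mpr hy)
  · rw [if_pos h.ge, ← hasDerivWithinAt_univ, ← Iic_union_Ici (a := (0 : ℝ))]
    refine HasDerivWithinAt.union ?_ ?_
    · rw [h0' h]
      refine (hg h.le).hasDerivWithinAt.congr (fun y hy => ?_) (by simp [h, h0])
      rcases (show y ≤ 0 from hy).lt_or_eq with h | rfl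
      · exact if_neg (not_le.mpr h)
      · simp [h0]
    · exact (hf h.ge).hasDerivWithinAt.congr (fun y hy => if_pos hy) (by simp [h])
  · rw [if_pos h.le]
    refine (hf h.le).congr_of_eventuallyEq ?_
    filter_upwards [Ioi_mem_nhds h] with y hy using if_pos (le_of_lt hy)

/-- That is, 1 + d/dx lowers `a`. The derivatives of the two branches match at 0 by the symmetry of
`kernelCoeff`. -/
lemma hasDerivAt_splineKernel_succ_left (a b : ℕ) (x : ℝ) :
    HasDerivAt (splineKernel (a + 1) b) (splineKernel a b x - splineKernel (a + 1) b x) x := by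
  have he : HasDerivAt (fun x => Real.exp (-x)) (-Real.exp (-x)) x := by
    simpa using (hasDerivAt_neg x).exp
  have hr : HasDerivAt (fun x => kernelPoly b (a + 1) (-x))
      (-(2 * kernelPoly b (a + 1) (-x) - kernelPoly b a (-x))) x := by
    exact ((hasDerivAt_kernelPoly b a (-x)).comp x (hasDerivAt_neg x)).congr_deriv (by ring)
  have := HasDerivAt.ite_nonneg (x := x) (f := fun x => Real.exp (-x) * kernelPoly (a + 1) b x)
    (g := fun x => Real.exp x * kernelPoly b (a + 1) (-x))
    (by simp [kernelPoly_apply_zero, kernelCoeff_comm b])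
    (fun _ => he.mul (hasDerivAt_kernelPoly_succ a b x)) (fun _ => (Real.hasDerivAt_exp x).mul hr)
    (by
      rintro rfl
      simp only [neg_zero, Real.exp_zero, kernelPoly_apply_zero, kernelCoeff_comm b]
      ring)
  refine this.congr_deriv ?_
  simp only [splineKernel]
  split_ifs <;> ring

lemma hasDerivAt_splineKernel_succ_right (a b : ℕ) (x : ℝ) :
    HasDerivAt (splineKernel a (b + 1)) (splineKernel a (b + 1) x - splineKernel a b x) x := by
  have h := (hasDerivAt_splineKernel_succ_left b a (-x)).comp x (hasDerivAt_neg x)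
  have e : splineKernel (b + 1) a ∘ (fun x => -x) = splineKernel a (b + 1) :=
    funext fun x => splineKernel_neg _ _ x
  rw [splineKernel_neg, splineKernel_neg] at h
  rw [← e]
  exact h.congr_deriv (by simp only [← e]; simp [splineKernel_neg])

lemma continuous_splineKernel (a b : ℕ) : Continuous (splineKernel a b) := by
  unfold splineKernel
  refine Continuous.if_le ?_ ?_ continuous_const continuous_id ?_
  · exact (Real.continuous_exp.comp continuous_neg).mul (contDiff_kernelPoly a b (n := 0)).continuous
  · exact Real.continuous_exp.mul
      ((contDiff_kernelPoly b a (n := 0)).continuous.comp continuous_neg)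
  · rintro x rfl
    simp [kernelPoly_apply_zero, kernelCoeff_comm a b]

/-! ### Rescaled kernels: derivative bounds and annihilating operators -/

/-- The rescaled kernel centred at `y`. -/
noncomputable def scaledKernel (κ y : ℝ) (a b : ℕ) (t : ℝ) : ℂ := splineKernel a b (κ * (t - y))

lemma hasDerivAt_scaledKernel_succ_left (κ y : ℝ) (a b : ℕ) (t : ℝ) :
    HasDerivAt (scaledKernel κ y (a + 1) b)
      (κ * (scaledKernel κ y a b t - scaledKernel κ y (a + 1) b t)) t := by
  have h : HasDerivAt (fun t => κ * (t - y)) κ t := by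
    simpa using ((hasDerivAt_id t).sub_const y).const_mul κ
  refine ((hasDerivAt_splineKernel_succ_left a b (κ * (t - y))).comp t h).ofReal_comp.congr_deriv ?_
  simp only [scaledKernel]; push_cast; ring

lemma hasDerivAt_scaledKernel_succ_right (κ y : ℝ) (a b : ℕ) (t : ℝ) :
    HasDerivAt (scaledKernel κ y a (b + 1))
      (κ * (scaledKernel κ y a (b + 1) t - scaledKernel κ y a b t)) t := by
  have h : HasDerivAt (fun t => κ * (t - y)) κ t := by
    simpa using ((hasDerivAt_id t).sub_const y).const_mul κ
  refine ((hasDerivAt_splineKernel_succ_right a b (κ * (t - y))).comp t h).ofReal_comp.congr_deriv ?_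
  simp only [scaledKernel]; push_cast; ring

lemma continuous_scaledKernel (κ y : ℝ) (a b : ℕ) : Continuous (scaledKernel κ y a b) :=
  Complex.continuous_ofReal.comp ((continuous_splineKernel a b).comp (by fun_prop))

lemma norm_scaledKernel_le_one (κ y : ℝ) (a b : ℕ) (t : ℝ) : ‖scaledKernel κ y a b t‖ ≤ 1 := by
  rw [scaledKernel, Complex.norm_real, Real.norm_of_nonneg (splineKernel_nonneg _ _ _)]
  exact splineKernel_le_one _ _ _

/-- Some index is positive, so one of the two derivative rules applies; each derivative costs at
most one unit of `a + b`. -/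
lemma exists_deriv_scaledKernel (κ y : ℝ) {a b m : ℕ} (h : m + 1 ≤ a + b) :
    ∃ a₁ b₁ a₂ b₂ : ℕ, m ≤ a₁ + b₁ ∧ m ≤ a₂ + b₂ ∧ ∀ t, HasDerivAt (scaledKernel κ y a b)
      (κ * (scaledKernel κ y a₁ b₁ t - scaledKernel κ y a₂ b₂ t)) t := by
  cases a with
  | succ a => exact ⟨a, b, a + 1, b, by omega, by omega, hasDerivAt_scaledKernel_succ_left κ y a b⟩
  | zero =>
    cases b with
    | succ b =>
      exact ⟨0, b + 1, 0, b, by omega, by omega, hasDerivAt_scaledKernel_succ_right κ y 0 b⟩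
    | zero => omega

lemma contDiff_scaledKernel (κ y : ℝ) {a b m : ℕ} (h : m ≤ a + b) :
    ContDiff ℝ m (scaledKernel κ y a b) := by
  induction m generalizing a b with
  | zero => exact contDiff_zero.mpr (continuous_scaledKernel κ y a b)
  | succ m ih =>
    obtain ⟨a₁, b₁, a₂, b₂, h₁, h₂, hd⟩ := exists_deriv_scaledKernel κ y h
    rw [Nat.cast_add, Nat.cast_one, contDiff_succ_iff_deriv]
    refine ⟨fun t => (hd t).differentiableAt, by simp, ?_⟩
    rw [funext fun t => (hd t).deriv]
    exact contDiff_const.mul ((ih h₁).sub (ih h₂))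

lemma norm_iteratedDeriv_scaledKernel_le {κ : ℝ} (hκ : 0 ≤ κ) (y : ℝ) {a b m : ℕ}
    (h : m ≤ a + b) (t : ℝ) : ‖iteratedDeriv m (scaledKernel κ y a b) t‖ ≤ (2 * κ) ^ m := by
  induction m generalizing a b with
  | zero => simpa using norm_scaledKernel_le_one κ y a b t
  | succ m ih =>
    obtain ⟨a₁, b₁, a₂, b₂, h₁, h₂, hd⟩ := exists_deriv_scaledKernel κ y h
    have e : deriv (scaledKernel κ y a b) =
        (κ : ℂ) • (scaledKernel κ y a₁ b₁ - scaledKernel κ y a₂ b₂) :=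
      funext fun t => (hd t).deriv
    rw [iteratedDeriv_succ', e, iteratedDeriv_const_smul_field,
      iteratedDeriv_sub (contDiff_scaledKernel κ y h₁).contDiffAt
        (contDiff_scaledKernel κ y h₂).contDiffAt, norm_smul, Complex.norm_real,
      Real.norm_of_nonneg hκ]
    calc κ * _ ≤ κ * ((2 * κ) ^ m + (2 * κ) ^ m) :=
          mul_le_mul_of_nonneg_left ((norm_sub_le _ _).trans (add_le_add (ih h₁) (ih h₂))) hκ
      _ = (2 * κ) ^ (m + 1) := by ring

lemma scaledKernel_zero_left {κ y : ℝ} (hκ : 0 < κ) (b : ℕ) {t : ℝ} (ht : y < t) :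
    scaledKernel κ y 0 b t = Real.exp (-(κ * (t - y))) * kernelCoeff 0 b := by
  rw [scaledKernel, splineKernel_of_nonneg _ _ (mul_nonneg hκ.le (sub_nonneg.mpr ht.le)),
    kernelPoly_zero_left, Complex.ofReal_mul]

lemma scaledKernel_zero_right {κ y : ℝ} (hκ : 0 < κ) (a : ℕ) {t : ℝ} (ht : t < y) :
    scaledKernel κ y a 0 t = Real.exp (κ * (t - y)) * kernelCoeff 0 a := by
  rw [scaledKernel, splineKernel_of_nonpos _ _ (by nlinarith), kernelPoly_zero_left,
    Complex.ofReal_mul]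

lemma firstOrderOp_smul (c : ℝ) (d : ℂ) (f : ℝ → ℂ) :
    firstOrderOp c (d • f) = d • firstOrderOp c f := by
  ext t
  simp only [firstOrderOp, Pi.smul_apply, smul_eq_mul, deriv_const_smul_field]
  ring

lemma firstOrderOp_iterate_scaledKernel_left (κ y : ℝ) (a b j : ℕ) :
    (firstOrderOp (-κ))^[j] (scaledKernel κ y (a + j) b) =
      ((κ : ℂ) ^ j) • scaledKernel κ y a b := by
  induction j generalizing a with
  | zero => simp
  | succ j ih =>
    rw [Function.iterate_succ_apply', show a + (j + 1) = (a + 1) + j by ring, ih,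
      firstOrderOp_smul]
    ext t
    simp only [Pi.smul_apply, firstOrderOp, (hasDerivAt_scaledKernel_succ_left κ y a b t).deriv,
      smul_eq_mul]
    push_cast; ring

lemma firstOrderOp_iterate_scaledKernel_right (κ y : ℝ) (a b j : ℕ) :
    (firstOrderOp κ)^[j] (scaledKernel κ y a (b + j)) =
      ((-κ : ℂ) ^ j) • scaledKernel κ y a b := by
  induction j generalizing b with
  | zero => simp
  | succ j ih =>
    rw [Function.iterate_succ_apply', show b + (j + 1) = (b + 1) + j by ring, ih,
      firstOrderOp_smul]
    ext t
    simp only [Pi.smul_apply, firstOrderOp, (hasDerivAt_scaledKernel_succ_right κ y a b t).deriv,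
      smul_eq_mul]
    ring

/-- After `a` applications the left index is 0, and to the right of `y` only a multiple of e^{-κ(t -
y)} remains, which the last application kills. -/
lemma firstOrderOp_iterate_scaledKernel_of_gt {κ y : ℝ} (hκ : 0 < κ) (a b : ℕ) {t : ℝ}
    (ht : y < t) : (firstOrderOp (-κ))^[a + 1] (scaledKernel κ y a b) t = 0 := by
  have h := firstOrderOp_iterate_scaledKernel_left κ y 0 b a
  rw [zero_add] at h
  have hev : scaledKernel κ y 0 b =ᶠ[𝓝 t]
      fun t => ((Real.exp (-(κ * (t - y))) * kernelCoeff 0 b : ℝ) : ℂ) := by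
    filter_upwards [Ioi_mem_nhds ht] with u hu
    rw [scaledKernel_zero_left hκ b hu, Complex.ofReal_mul]
  have hd : HasDerivAt (fun t => Real.exp (-(κ * (t - y))) * kernelCoeff 0 b)
      (Real.exp (-(κ * (t - y))) * (-κ) * kernelCoeff 0 b) t := by
    simpa using (((((hasDerivAt_id t).sub_const y).const_mul κ).neg).exp.mul_const
      (kernelCoeff 0 b))
  rw [Function.iterate_succ_apply', h, firstOrderOp_smul, Pi.smul_apply, firstOrderOp,
    hev.deriv_eq, hd.ofReal_comp.deriv, hev.eq_of_nhds]
  push_cast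
  rw [smul_eq_mul]; ring

lemma firstOrderOp_iterate_scaledKernel_of_lt {κ y : ℝ} (hκ : 0 < κ) (a b : ℕ) {t : ℝ}
    (ht : t < y) : (firstOrderOp κ)^[b + 1] (scaledKernel κ y a b) t = 0 := by
  have h := firstOrderOp_iterate_scaledKernel_right κ y a 0 b
  rw [zero_add] at h
  have hev : scaledKernel κ y a 0 =ᶠ[𝓝 t]
      fun t => ((Real.exp (κ * (t - y)) * kernelCoeff 0 a : ℝ) : ℂ) := by
    filter_upwards [Iio_mem_nhds ht] with u hu
    rw [scaledKernel_zero_right hκ a hu, Complex.ofReal_mul]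
  have hd : HasDerivAt (fun t => Real.exp (κ * (t - y)) * kernelCoeff 0 a)
      (Real.exp (κ * (t - y)) * κ * kernelCoeff 0 a) t := by
    simpa using ((((hasDerivAt_id t).sub_const y).const_mul κ).exp.mul_const (kernelCoeff 0 a))
  rw [Function.iterate_succ_apply', h, firstOrderOp_smul, Pi.smul_apply, firstOrderOp,
    hev.deriv_eq, hd.ofReal_comp.deriv, hev.eq_of_nhds]
  push_cast
  rw [smul_eq_mul]; ring

lemma contDiffOn_scaledKernel_Ioi {κ : ℝ} (hκ : 0 < κ) (y : ℝ) (a b n : ℕ) :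
    ContDiffOn ℝ n (scaledKernel κ y a b) (Ioi y) := by
  have h : ContDiff ℝ n fun t : ℝ =>
      ((Real.exp (-(κ * (t - y))) * kernelPoly a b (κ * (t - y)) : ℝ) : ℂ) := by
    refine Complex.ofRealCLM.contDiff.comp (ContDiff.mul (by fun_prop) ?_)
    exact (contDiff_kernelPoly a b).comp (by fun_prop)
  refine h.contDiffOn.congr fun t ht => ?_
  rw [scaledKernel,
    splineKernel_of_nonneg _ _ (mul_nonneg hκ.le (sub_nonneg.mpr (le_of_lt ht)))]

lemma contDiffOn_scaledKernel_Iio {κ : ℝ} (hκ : 0 < κ) (y : ℝ) (a b n : ℕ) :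
    ContDiffOn ℝ n (scaledKernel κ y a b) (Iio y) := by
  have h : ContDiff ℝ n fun t : ℝ =>
      ((Real.exp (κ * (t - y)) * kernelPoly b a (-(κ * (t - y))) : ℝ) : ℂ) := by
    refine Complex.ofRealCLM.contDiff.comp (ContDiff.mul (by fun_prop) ?_)
    exact (contDiff_kernelPoly b a).comp (by fun_prop)
  refine h.contDiffOn.congr fun t ht => ?_
  rw [scaledKernel, splineKernel_of_nonpos _ _
    (mul_nonpos_of_nonneg_of_nonpos hκ.le (sub_nonpos.mpr (le_of_lt ht)))]

/-! ### Invertibility of the Gram matrix -/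

/-- The causal function `y_+^a e^{-y}`. -/
noncomputable def causalExp (a : ℕ) (y : ℝ) : ℝ := max y 0 ^ a * Real.exp (-y)

lemma continuous_causalExp (a : ℕ) : Continuous (causalExp a) := by
  unfold causalExp; fun_prop

lemma causalExp_of_nonpos {a : ℕ} (ha : a ≠ 0) {y : ℝ} (hy : y ≤ 0) : causalExp a y = 0 := by
  rw [causalExp, max_eq_right hy, zero_pow ha, zero_mul]

lemma causalExp_pos (a : ℕ) {y : ℝ} (hy : 0 < y) : 0 < causalExp a y := by
  rw [causalExp, max_eq_left hy.le]; positivity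

lemma integrableOn_pow_mul_exp_neg_two_mul (n : ℕ) :
    IntegrableOn (fun z : ℝ => z ^ n * Real.exp (-(2 * z))) (Ioi 0) := by
  have := integrableOn_rpow_mul_exp_neg_mul_rpow (s := n) (p := 1) (b := 2)
    (by linarith [Nat.cast_nonneg (α := ℝ) n]) one_pos two_pos
  simpa using this

lemma integral_pow_mul_exp_neg_two_mul (n : ℕ) :
    ∫ z in Ioi (0 : ℝ), z ^ n * Real.exp (-(2 * z)) = n.factorial / 2 ^ (n + 1) := by
  have := Real.integral_rpow_mul_exp_neg_mul_Ioi (a := n + 1) (r := 2) (by positivity) two_pos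
  rw [add_sub_cancel_right, Real.Gamma_nat_eq_factorial] at this
  rw [show (fun z : ℝ => z ^ n * Real.exp (-(2 * z))) =
    fun z : ℝ => z ^ (n : ℝ) * Real.exp (-(2 * z)) by simp, this,
    show ((n : ℝ) + 1) = ((n + 1 : ℕ) : ℝ) by push_cast; ring, Real.rpow_natCast, one_div, inv_pow]
  field_simp

/-- Expanding (z + d)^a binomially leaves Gamma integrals (2a - i)!/2^{2a-i+1}, which reassemble
into the coefficients of `kernelPoly`. -/
lemma integrable_and_integral_causalExp_mul_of_nonneg {a : ℕ} (ha : a ≠ 0) {d : ℝ} (hd : 0 ≤ d) :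
    Integrable (fun z => causalExp a z * causalExp a (z + d)) ∧
    ∫ z, causalExp a z * causalExp a (z + d) = (a.factorial : ℝ) ^ 2 * splineKernel a a d := by
  have hind : (fun z => causalExp a z * causalExp a (z + d)) = (Ioi 0).indicator
      fun z => ∑ i ∈ Finset.range (a + 1), (Real.exp (-d) * d ^ i * a.choose i) *
        (z ^ (2 * a - i) * Real.exp (-(2 * z))) := by
    ext z
    by_cases hz : z ∈ Ioi (0 : ℝ)
    · have hz0 : 0 < z := hz
      rw [indicator_of_mem hz, causalExp, causalExp, max_eq_left hz0.le,
        max_eq_left (by linarith), add_comm z d, add_pow,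
        show -(d + z) = -d + -z by ring, Real.exp_add,
        show -(2 * z) = -z + -z by ring, Real.exp_add, Finset.sum_mul, Finset.mul_sum]
      refine Finset.sum_congr rfl fun i hi => ?_
      rw [show 2 * a - i = a + (a - i) by have := Finset.mem_range.mp hi; omega, pow_add]
      ring
    · rw [indicator_of_notMem hz, causalExp_of_nonpos ha (not_lt.mp hz), zero_mul]
  have hint : ∀ i ∈ Finset.range (a + 1), Integrable (fun z : ℝ =>
      (Real.exp (-d) * d ^ i * a.choose i) * (z ^ (2 * a - i) * Real.exp (-(2 * z))))
      (volume.restrict (Ioi 0)) := fun i _ =>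
    (integrableOn_pow_mul_exp_neg_two_mul _).const_mul _
  rw [hind]
  refine ⟨(integrable_indicator_iff measurableSet_Ioi).mpr (integrable_finsetSum _ hint), ?_⟩
  rw [integral_indicator measurableSet_Ioi, integral_finsetSum _ hint,
    splineKernel_of_nonneg _ _ hd, kernelPoly, Finset.mul_sum, Finset.mul_sum]
  refine Finset.sum_congr rfl fun i hi => ?_
  have hi' : i ≤ a := Nat.lt_succ_iff.mp (Finset.mem_range.mp hi)
  rw [integral_const_mul, integral_pow_mul_exp_neg_two_mul, kernelCoeff,
    show a - i + a = 2 * a - i by omega, Nat.cast_choose ℝ hi',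
    Nat.cast_choose ℝ (show a ≤ 2 * a - i by omega), show 2 * a - i - a = a - i by omega]
  field_simp

lemma integrable_and_integral_causalExp_mul {a : ℕ} (ha : a ≠ 0) (x y : ℝ) :
    Integrable (fun z => causalExp a (z - x) * causalExp a (z - y)) ∧
    ∫ z, causalExp a (z - x) * causalExp a (z - y) =
      (a.factorial : ℝ) ^ 2 * splineKernel a a (x - y) := by
  have key : ∀ x y : ℝ, y ≤ x → Integrable (fun z => causalExp a (z - x) * causalExp a (z - y)) ∧
      ∫ z, causalExp a (z - x) * causalExp a (z - y) =
        (a.factorial : ℝ) ^ 2 * splineKernel a a (x - y) := fun x y h => by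
    obtain ⟨h1, h2⟩ := integrable_and_integral_causalExp_mul_of_nonneg ha (sub_nonneg.mpr h)
    have e : (fun z => causalExp a (z - x) * causalExp a (z - y)) =
        fun z => (fun z => causalExp a z * causalExp a (z + (x - y))) (z - x) := by
      ext z; simp
    rw [e]
    exact ⟨h1.comp_sub_right x, (integral_sub_right_eq_self _ x).trans h2⟩
  rcases le_total y x with h | h
  · exact key x y h
  · have := key y x h
    rw [← splineKernel_neg, neg_sub] at this
    simpa only [mul_comm] using this

/-- Translates of `causalExp a` are linearly independent. -/
lemma eq_zero_of_sum_causalExp {ι : Type*} [Fintype ι] [LinearOrder ι] {a : ℕ} (ha : a ≠ 0)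
    {x : ι → ℝ} (hx : StrictMono x) {c : ι → ℝ}
    (h : ∀ z, ∑ j, c j * causalExp a (z - x j) = 0) : c = 0 := by
  by_contra hc
  have hne : (Finset.univ.filter fun j => c j ≠ 0).Nonempty := by
    obtain ⟨j, hj⟩ := Function.ne_iff.mp hc
    exact ⟨j, by simpa using hj⟩
  set j := Finset.min' _ hne with hjdef
  have hj : c j ≠ 0 := (Finset.mem_filter.mp (Finset.min'_mem _ hne)).2
  have hlt : ∀ i < j, c i = 0 := fun i hi => by
    by_contra hci
    exact absurd (Finset.min'_le _ i (by simpa using hci)) (not_le.mpr hi)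
  -- Just to the right of x_j, with j the least index in the support of c, no later translate has
  -- started, so only the j-th term survives.
  have hev : ∀ᶠ t in 𝓝[>] (x j), ∀ i, j < i → t < x i :=
    eventually_all.mpr fun i => by
      by_cases hji : j < i
      · filter_upwards [nhdsWithin_le_nhds (Iio_mem_nhds (hx hji))] with t ht _ using ht
      · exact Eventually.of_forall fun t h => absurd h hji
  obtain ⟨z, hz, hzj⟩ := (hev.and self_mem_nhdsWithin).exists
  have := h z
  rw [Finset.sum_eq_single j] at this
  · exact (mul_ne_zero hj (causalExp_pos a (sub_pos.mpr hzj)).ne') this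
  · intro i _ hij
    rcases lt_or_gt_of_ne hij with h | h
    · rw [hlt i h, zero_mul]
    · rw [causalExp_of_nonpos ha (sub_nonpos.mpr (hz i h).le), mul_zero]
  · simp

/-- The matrix of values of the rescaled kernel at differences of knots. -/
noncomputable def gramMatrix {ι : Type*} (a : ℕ) (τ : ι → ℝ) (κ : ℝ) : Matrix ι ι ℝ :=
  Matrix.of fun i j => splineKernel a a (κ * (τ i - τ j))

/-- For c in the kernel of the matrix, the combination F of translates has ∫ F² = (a!)² cᵀGc = 0. By
continuity F = 0, and independence of the translates gives c = 0. -/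
lemma det_gramMatrix_ne_zero {ι : Type*} [Fintype ι] [LinearOrder ι] {a : ℕ} (ha : a ≠ 0)
    {τ : ι → ℝ} (hτ : StrictMono τ) {κ : ℝ} (hκ : 0 < κ) : (gramMatrix a τ κ).det ≠ 0 := by
  intro hdet
  obtain ⟨c, hc, hc0⟩ := Matrix.exists_mulVec_eq_zero_iff.mpr hdet
  refine hc (eq_zero_of_sum_causalExp (x := fun i => κ * τ i) ha
    (fun i j hij => mul_lt_mul_of_pos_left (hτ hij) hκ) ?_)
  set F : ℝ → ℝ := fun z => ∑ j, c j * causalExp a (z - κ * τ j) with hF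
  have hexp : ∀ z, F z ^ 2 = ∑ i, ∑ j, (c i * c j) *
      (causalExp a (z - κ * τ i) * causalExp a (z - κ * τ j)) := fun z => by
    rw [hF, pow_two, Finset.sum_mul_sum]
    exact Finset.sum_congr rfl fun i _ => Finset.sum_congr rfl fun j _ => by ring
  have hcont : Continuous F :=
    continuous_finsetSum _ fun j _ =>
      continuous_const.mul ((continuous_causalExp a).comp (by fun_prop))
  have hint : ∀ i j, Integrable fun z => (c i * c j) *
      (causalExp a (z - κ * τ i) * causalExp a (z - κ * τ j)) := fun i j =>
    (integrable_and_integral_causalExp_mul ha _ _).1.const_mul _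
  have hFint : Integrable fun z => F z ^ 2 := by
    rw [funext hexp]
    exact integrable_finsetSum _ fun i _ => integrable_finsetSum _ fun j _ => hint i j
  have hzero : ∫ z, F z ^ 2 = 0 := by
    rw [funext hexp, integral_finsetSum _ fun i _ => integrable_finsetSum _ fun j _ => hint i j]
    refine Finset.sum_eq_zero fun i _ => ?_
    rw [integral_finsetSum _ fun j _ => hint i j]
    have h1 := congrFun hc0 i
    rw [Matrix.mulVec, dotProduct, Pi.zero_apply] at h1
    calc _ = ∑ j, c i * (a.factorial : ℝ) ^ 2 * (gramMatrix a τ κ i j * c j) := by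
          refine Finset.sum_congr rfl fun j _ => ?_
          rw [integral_const_mul, (integrable_and_integral_causalExp_mul ha _ _).2, gramMatrix,
            Matrix.of_apply, mul_sub]
          ring
      _ = 0 := by rw [← Finset.mul_sum, h1, mul_zero]
  have hae := (integral_eq_zero_iff_of_nonneg (fun z => sq_nonneg (F z)) hFint).mp hzero
  have heq := (Continuous.ae_eq_iff_eq volume (hcont.pow 2) continuous_const).mp hae
  exact fun z => pow_eq_zero_iff two_ne_zero |>.mp (congrFun heq z)

/-! ### Uniform bound for the inverse Gram matrix -/

lemma continuous_gramMatrix {ι : Type*} (a : ℕ) (τ : ι → ℝ) : Continuous (gramMatrix a τ) :=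
  continuous_matrix fun i j => (continuous_splineKernel a a).comp (by fun_prop)

lemma tendsto_gramMatrix {ι : Type*} [DecidableEq ι] (a : ℕ) {τ : ι → ℝ}
    (hτ : Function.Injective τ) :
    Tendsto (gramMatrix a τ) atTop (𝓝 (kernelCoeff a a • (1 : Matrix ι ι ℝ))) := by
  refine tendsto_pi_nhds.mpr fun i => tendsto_pi_nhds.mpr fun j => ?_
  rw [Matrix.smul_apply]
  rcases lt_trichotomy (τ i) (τ j) with h | h | h
  · rw [Matrix.one_apply_ne (fun e => h.ne (by rw [e])), smul_zero]
    exact (tendsto_splineKernel_atBot a a).comp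
      (tendsto_id.atTop_mul_const_of_neg (sub_neg.mpr h))
  · obtain rfl := hτ h
    refine tendsto_const_nhds.congr fun κ => ?_
    simp [gramMatrix, splineKernel_zero]
  · rw [Matrix.one_apply_ne (fun e => h.ne (by rw [e])), smul_zero]
    exact (tendsto_splineKernel_atTop a a).comp (tendsto_id.atTop_mul_const (sub_pos.mpr h))

lemma exists_bound_of_continuousOn_Ici_of_tendsto {f : ℝ → ℝ} {b l : ℝ}
    (hf : ContinuousOn f (Ici b)) (hl : Tendsto f atTop (𝓝 l)) :
    ∃ B, ∀ x ∈ Ici b, |f x| ≤ B := by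
  obtain ⟨M, hM⟩ := eventually_atTop.mp
    (hl.abs.eventually_le_const (lt_add_one |l|))
  obtain ⟨B, hB⟩ := isCompact_Icc.exists_bound_of_continuousOn
    (hf.mono (Icc_subset_Ici_self : Icc b M ⊆ Ici b))
  refine ⟨max B (|l| + 1), fun x hx => ?_⟩
  rcases le_total x M with h | h
  · exact (hB x ⟨hx, h⟩).trans (le_max_left _ _)
  · exact (hM x h).trans (le_max_right _ _)

/-- The inverse Gram matrices are bounded uniformly in `κ ≥ b > 0`. -/
lemma exists_bound_inv_gramMatrix {ι : Type*} [Fintype ι] [LinearOrder ι] {a : ℕ} (ha : a ≠ 0)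
    {τ : ι → ℝ} (hτ : StrictMono τ) {b : ℝ} (hb : 0 < b) :
    ∃ B, 0 ≤ B ∧ ∀ κ, b ≤ κ → ∀ i j, |(gramMatrix a τ κ)⁻¹ i j| ≤ B := by
  have hlim0 : (kernelCoeff a a • (1 : Matrix ι ι ℝ)).det ≠ 0 := by
    rw [Matrix.det_smul, Matrix.det_one, mul_one]
    refine pow_ne_zero _ (div_ne_zero ?_ (by positivity))
    exact_mod_cast (Nat.choose_pos (Nat.le_add_left a a)).ne'
  -- The adjugate formula gives continuity of inversion at nonsingular matrices, both along κ ≥ b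
  -- and at the limit κ → ∞.
  have hinv : ∀ A : Matrix ι ι ℝ, A.det ≠ 0 → ContinuousAt (fun A => A⁻¹) A := fun A hA => by
    have : (fun A : Matrix ι ι ℝ => A⁻¹) = fun A => (A.det)⁻¹ • A.adjugate := by
      ext1 A; rw [Matrix.inv_def, Ring.inverse_eq_inv']
    rw [this]
    exact (ContinuousAt.inv₀ (Continuous.matrix_det continuous_id).continuousAt hA).smul
      (Continuous.matrix_adjugate continuous_id).continuousAt
  have hex : ∀ i j, ∃ B, ∀ κ ∈ Ici b, |(gramMatrix a τ κ)⁻¹ i j| ≤ B := fun i j => by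
    have hentry : Continuous fun A : Matrix ι ι ℝ => A i j := continuous_id.matrix_elem i j
    refine exists_bound_of_continuousOn_Ici_of_tendsto (fun κ hκ => ?_)
      ((hentry.tendsto _).comp ((hinv _ hlim0).tendsto.comp (tendsto_gramMatrix a hτ.injective)))
    have h1 := ContinuousAt.comp (f := gramMatrix a τ) (x := κ)
      (hinv _ (det_gramMatrix_ne_zero ha hτ (hb.trans_le hκ)))
      (continuous_gramMatrix a τ).continuousAt
    exact (ContinuousAt.comp (x := κ) hentry.continuousAt h1).continuousWithinAt
  choose B hB using hex
  refine ⟨∑ i, ∑ j, |B i j|, by positivity, fun κ hκ i j => (hB i j κ hκ).trans ?_⟩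
  calc B i j ≤ |B i j| := le_abs_self _
    _ ≤ ∑ j, |B i j| := Finset.single_le_sum (f := fun j => |B i j|) (fun _ _ => abs_nonneg _)
        (Finset.mem_univ j)
    _ ≤ ∑ i, ∑ j, |B i j| := Finset.single_le_sum (f := fun i => ∑ j, |B i j|)
        (fun _ _ => by positivity) (Finset.mem_univ i)

/-! ### Lagrange functions and the main estimate -/

/-- The only breakpoint is the centre τ_k, so every piece lies on one side of it, where one of the
two factors of the operator already annihilates the kernel. -/
lemma isNaturalLSpline_scaledKernel {a N n : ℕ} (ha : a ≠ 0) {τ : Fin (N + 1) → ℝ}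
    (hτ : StrictMono τ) {ξ : EuclideanSpace ℝ (Fin n)} (hξ : 0 < ‖ξ‖) (k : Fin (N + 1)) :
    IsNaturalLSpline (a + 1) τ ξ (scaledKernel ‖ξ‖ (τ k) a a) := by
  have hr : ∀ t ∈ Ioi (τ k),
      diffOp ((X - C ((-‖ξ‖ : ℝ) : ℂ)) ^ (a + 1)) (scaledKernel ‖ξ‖ (τ k) a a) t = 0 :=
    fun t ht => by
      rw [← firstOrderOp_iterate_eq_diffOp isOpen_Ioi _
        (contDiffOn_scaledKernel_Ioi hξ (τ k) a a (a + 1)) le_rfl t ht]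
      exact firstOrderOp_iterate_scaledKernel_of_gt hξ a a ht
  have hl : ∀ t ∈ Iio (τ k),
      diffOp ((X - C (‖ξ‖ : ℂ)) ^ (a + 1)) (scaledKernel ‖ξ‖ (τ k) a a) t = 0 :=
    fun t ht => by
      rw [← firstOrderOp_iterate_eq_diffOp isOpen_Iio _
        (contDiffOn_scaledKernel_Iio hξ (τ k) a a (a + 1)) le_rfl t ht]
      exact firstOrderOp_iterate_scaledKernel_of_lt hξ a a ht
  have hsub : ∀ j, openPiece τ j ⊆ Ioi (τ k) ∨ openPiece τ j ⊆ Iio (τ k) := fun j =>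
    (lt_or_ge (k : ℕ) j).imp (fun h t ht => ht.1 k h) (fun h t ht => ht.2 k h)
  refine (isNaturalLSpline_iff (by omega) τ ξ _).mpr
    ⟨contDiff_scaledKernel _ _ (by omega), fun j => ?_, fun j t ht => ?_,
      fun t ht => hl t (ht.trans_le (hτ.monotone (Fin.zero_le k))),
      fun t ht => hr t ((hτ.monotone (Fin.le_last k)).trans_lt ht)⟩
  · rcases hsub j with h | h
    · exact (contDiffOn_scaledKernel_Ioi hξ (τ k) a a _).mono h
    · exact (contDiffOn_scaledKernel_Iio hξ (τ k) a a _).mono h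
  · rcases hsub j with h | h
    · rw [mul_comm]
      exact diffOp_pow_mul_eq_zero isOpen_Ioi
        (contDiffOn_scaledKernel_Ioi hξ (τ k) a a _) _ le_rfl hr t (h ht)
    · exact diffOp_pow_mul_eq_zero isOpen_Iio
        (contDiffOn_scaledKernel_Iio hξ (τ k) a a _) _ le_rfl hl t (h ht)

/-- The Lagrange function as a combination of translated kernels. -/
noncomputable def lagrangeSpline (a : ℕ) {N : ℕ} (τ : Fin (N + 1) → ℝ) (κ : ℝ)
    (j : Fin (N + 1)) : ℝ → ℂ :=
  ∑ k, (((gramMatrix a τ κ)⁻¹ j k : ℝ) : ℂ) • scaledKernel κ (τ k) a a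

lemma lagrangeSpline_apply_knot {a N : ℕ} (ha : a ≠ 0) {τ : Fin (N + 1) → ℝ}
    (hτ : StrictMono τ) {κ : ℝ} (hκ : 0 < κ) (j i : Fin (N + 1)) :
    lagrangeSpline a τ κ j (τ i) = if j = i then 1 else 0 := by
  have h := congrFun (congrFun (Matrix.nonsing_inv_mul (gramMatrix a τ κ)
    (isUnit_iff_ne_zero.mpr (det_gramMatrix_ne_zero ha hτ hκ))) j) i
  rw [Matrix.mul_apply, Matrix.one_apply] at h
  have h' : lagrangeSpline a τ κ j (τ i) =
      ((∑ k, (gramMatrix a τ κ)⁻¹ j k * gramMatrix a τ κ k i : ℝ) : ℂ) := by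
    rw [lagrangeSpline, Finset.sum_apply, Complex.ofReal_sum]
    refine Finset.sum_congr rfl fun k _ => ?_
    rw [Pi.smul_apply, smul_eq_mul, Complex.ofReal_mul, scaledKernel, gramMatrix, Matrix.of_apply,
      ← splineKernel_neg a a (κ * (τ k - τ i)), ← mul_neg, neg_sub]
  rw [h', h]
  split_ifs <;> simp

lemma isLagrangeFunction_lagrangeSpline {a N n : ℕ} (ha : a ≠ 0) {τ : Fin (N + 1) → ℝ}
    (hτ : StrictMono τ) {ξ : EuclideanSpace ℝ (Fin n)} (hξ : 0 < ‖ξ‖) (j : Fin (N + 1)) :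
    IsLagrangeFunction (a + 1) τ ξ j (lagrangeSpline a τ ‖ξ‖ j) := by
  refine ⟨?_, by rw [lagrangeSpline_apply_knot ha hτ hξ, if_pos rfl],
    fun k hk => by rw [lagrangeSpline_apply_knot ha hτ hξ, if_neg hk.symm]⟩
  exact (naturalSplineSpace (a + 1) (by omega) τ ξ).sum_mem fun k _ =>
    Submodule.smul_mem _ _ (isNaturalLSpline_scaledKernel ha hτ hξ k)

lemma norm_iteratedDeriv_lagrangeSpline_le {a N : ℕ} {τ : Fin (N + 1) → ℝ} {κ B : ℝ}
    (hκ : 0 ≤ κ) {j : Fin (N + 1)} (hB : ∀ k, |(gramMatrix a τ κ)⁻¹ j k| ≤ B) {m : ℕ}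
    (hm : m ≤ a + a) (t : ℝ) :
    ‖iteratedDeriv m (lagrangeSpline a τ κ j) t‖ ≤ (N + 1) * (B * (2 * κ) ^ m) := by
  have hC : ∀ k ∈ Finset.univ, ContDiffAt ℝ m
      ((((gramMatrix a τ κ)⁻¹ j k : ℝ) : ℂ) • scaledKernel κ (τ k) a a) t := fun k _ =>
    contDiffAt_const.smul (contDiff_scaledKernel κ (τ k) hm).contDiffAt
  rw [lagrangeSpline, iteratedDeriv_sum hC]
  refine (norm_sum_le_of_le _ (n := fun _ => B * (2 * κ) ^ m) fun k _ => ?_).trans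
    (by simp)
  rw [iteratedDeriv_const_smul_field, norm_smul, Complex.norm_real]
  exact mul_le_mul (hB k) (norm_iteratedDeriv_scaledKernel_le hκ (τ k) hm t) (norm_nonneg _)
    ((abs_nonneg _).trans (hB k))

lemma IsLagrangeFunction.unique {p N n : ℕ} (hp : 2 ≤ p) {τ : Fin (N + 1) → ℝ}
    (hτ : StrictMono τ) {ξ : EuclideanSpace ℝ (Fin n)} (hξ : 0 < ‖ξ‖)
    (hex : ∀ j, ∃ L, IsLagrangeFunction p τ ξ j L) {j : Fin (N + 1)} {L M : ℝ → ℂ}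
    (hL : IsLagrangeFunction p τ ξ j L) (hM : IsLagrangeFunction p τ ξ j M) : L = M := by
  have hs : IsNaturalLSpline p τ ξ (L - M) := (naturalSplineSpace p hp τ ξ).sub_mem hL.1 hM.1
  refine sub_eq_zero.mp (hs.eq_zero_of_knots hp hτ hξ hex fun k => ?_)
  rcases eq_or_ne k j with rfl | hk
  · rw [Pi.sub_apply, hL.2.1, hM.2.1, sub_self]
  · rw [Pi.sub_apply, hL.2.2 k hk, hM.2.2 k hk, sub_self]

theorem mainTheorem4 (p N : ℕ) (hp : 2 ≤ p) (hpN : p ≤ N + 1)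
    (τ : Fin (N + 1) → ℝ) (hτ : StrictMono τ) :
    ∃ C₀ : ℝ, 0 < C₀ ∧
      ∀ (n : ℕ) (ξ : EuclideanSpace ℝ (Fin n)), 1 / 2 ≤ ‖ξ‖ → ∀ j : Fin (N + 1),
        (∃! L : ℝ → ℂ, IsLagrangeFunction p τ ξ j L) ∧
        ∀ L : ℝ → ℂ, IsLagrangeFunction p τ ξ j L →
          ∀ m : ℕ, m ≤ 2 * p - 2 → ∀ t : ℝ,
            ‖iteratedDeriv m L t‖ ≤ C₀ * (1 + ‖ξ‖ ^ m) := by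
  obtain ⟨a, rfl⟩ : ∃ a, p = a + 1 := ⟨p - 1, by omega⟩
  have ha : a ≠ 0 := by omega
  obtain ⟨B, hB0, hB⟩ := exists_bound_inv_gramMatrix ha hτ (b := 1 / 2) (by norm_num)
  -- There are N + 1 kernels with coefficients at most B, and 2^m ≤ 2^(2a) because m ≤ 2p - 2 = 2a.
  -- The added 1 ensures positivity, as B may be 0.
  refine ⟨(N + 1) * (B * 2 ^ (2 * a)) + 1, by positivity, fun n ξ hξ j => ?_⟩
  have hξ0 : 0 < ‖ξ‖ := lt_of_lt_of_le (by norm_num) hξ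
  have hlag := isLagrangeFunction_lagrangeSpline ha hτ hξ0
  have huniq : ∀ L, IsLagrangeFunction (a + 1) τ ξ j L → L = lagrangeSpline a τ ‖ξ‖ j :=
    fun L hL => hL.unique hp hτ hξ0 (fun j => ⟨_, hlag j⟩) (hlag j)
  refine ⟨⟨_, hlag j, huniq⟩, fun L hL m hm t => ?_⟩
  rw [huniq L hL]
  calc ‖iteratedDeriv m (lagrangeSpline a τ ‖ξ‖ j) t‖
      ≤ (N + 1) * (B * (2 * ‖ξ‖) ^ m) :=
        norm_iteratedDeriv_lagrangeSpline_le hξ0.le (hB _ hξ j) (by omega) t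
    _ = (N + 1) * (B * 2 ^ m) * ‖ξ‖ ^ m := by ring
    _ ≤ ((N + 1) * (B * 2 ^ (2 * a)) + 1) * (1 + ‖ξ‖ ^ m) := by
        have h2 : (2 : ℝ) ^ m ≤ 2 ^ (2 * a) := pow_le_pow_right₀ one_le_two (by omega)
        have h3 : (0 : ℝ) ≤ ‖ξ‖ ^ m := by positivity
        refine mul_le_mul ?_ (by linarith) h3 (by positivity)
        have : ((N : ℝ) + 1) * (B * 2 ^ m) ≤ (N + 1) * (B * 2 ^ (2 * a)) := by gcongr
        linarith
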